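/- Let $\Omega\subset\mathbb R^2$ be a bounded open set, let $f\in L^2(\Omega)$ and $\mu>0$. For $u\in L^2(\Omega)$ let $$|Du|_1(\Omega)=\sup\Big\{\int_\Omega u\,\mathrm{div}\,\eta\,dx \;:\; \eta\in C^1_c(\Omega;\mathbb R^2),\ |\eta_1|\le 1,\ |\eta_2|\le 1\Big\}\in[0,+\infty]$$ be the total variation of $u$ with respect to the norm $|(v_1,v_2)|_1=|v_1|+|v_2|$. For $\lambda>0$ and $c_1,c_2\in[0,1]$ put $$AROF_\lambda(u)=|Du|_1(\Omega)+\frac{\lambda}{2}\int_\Omega (u-f)^2\,dx,$$ $$\mathcal G_\mu(u,c_1,c_2)=|Du|_1(\Omega)+\mu\int_\Omega\big(u(c_1-f)^2+(1-u)(c_2-f)^2\big)\,dx+\int_\Omega \mathbb I_{[0,1]}(u)\,dx,$$ where $\mathbb I_{[0,1]}(s)=0$ if $s\in[0,1]$ and $+\infty$ otherwise; in particular $\mathcal G_\mu(u,c_1,c_2)=+\infty$ unless $0\le u\le 1$ a.e. in $\Omega$. Theorem. Let $0\le c_2<c_1\le 1$ and let $w$ be a minimizer of $AROF_\lambda$ over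 $L^2(\Omega)$ with $\lambda=2\mu(c_1-c_2)$. Then the characteristic function $\chi_\Sigma$ of the super-level set $$\Sigma=\Big\{x\in\Omega : w(x)>\frac{c_1+c_2}{2}\Big\}$$ is a minimizer of $\mathcal G_\mu(\cdot,c_1,c_2)$ over $L^2(\Omega)$. -/

import Mathlib

open MeasureTheory Set
open scoped ENNReal

noncomputable section

namespace AnisoCV

/-- The Euclidean plane. -/
abbrev Plane : Type := EuclideanSpace ℝ (Fin 2)

/-- The `ℓ¹` norm on the plane. -/
def l1 (v : Plane) : ℝ := |v 0| + |v 1|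

/-- The divergence of a vector field on the plane. -/
def divergence (η : Plane → Plane) (x : Plane) : ℝ :=
  ∑ i : Fin 2, fderiv ℝ η x (EuclideanSpace.single i 1) i

/-- Admissible test fields for the total variation with respect to `φ`: fields in
`C¹_c(Ω; ℝ²)` whose values lie in the unit ball dual to `φ`. -/
structure IsTestField (φ : Plane → ℝ) (Ω : Set Plane) (η : Plane → Plane) : Prop where
  contDiff : ContDiff ℝ 1 η
  hasCompactSupport : HasCompactSupport η
  tsupport_subset : tsupport η ⊆ Ω
  dual_le : ∀ x v : Plane, inner ℝ (η x) v ≤ φ v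

/-- The total variation `|Du|_φ(Ω)`. The zero field is admissible when `φ ≥ 0`, so the supremum
is nonnegative and truncating the integrals at `0` does not change it. -/
def totalVariation (φ : Plane → ℝ) (Ω : Set Plane) (u : Plane → ℝ) : ℝ≥0∞ :=
  ⨆ (η : Plane → Plane) (_ : IsTestField φ Ω η),
    ENNReal.ofReal (∫ x in Ω, u x * divergence η x)

/-- The anisotropic ROF functional `|Du|₁(Ω) + (lam / 2) ∫_Ω (u - f)²`. -/
def AROF (Ω : Set Plane) (f : Plane → ℝ) (lam : ℝ) (u : Plane → ℝ) : ℝ≥0∞ :=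
  totalVariation l1 Ω u + ENNReal.ofReal (lam / 2) * ∫⁻ x in Ω, ENNReal.ofReal ((u x - f x) ^ 2)

/-- The indicator function of `[0, 1]` in the sense of convex analysis. -/
def convexIndicator (s : ℝ) : ℝ≥0∞ :=
  open Classical in if s ∈ Icc (0 : ℝ) 1 then 0 else ⊤

/-- The relaxed functional
`|Du|₁(Ω) + μ ∫_Ω (u (c₁ - f)² + (1 - u) (c₂ - f)²) + ∫_Ω 𝕀_{[0,1]}(u)`. The middle integrand is
nonnegative wherever `u ∈ [0, 1]`; if `u ∉ [0, 1]` on a set of positive measure, the last term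
makes the value infinite. -/
def relaxedG (Ω : Set Plane) (f : Plane → ℝ) (μ c₁ c₂ : ℝ) (u : Plane → ℝ) : ℝ≥0∞ :=
  totalVariation l1 Ω u
    + ENNReal.ofReal μ *
      (∫⁻ x in Ω, ENNReal.ofReal (u x * (c₁ - f x) ^ 2 + (1 - u x) * (c₂ - f x) ^ 2))
    + ∫⁻ x in Ω, convexIndicator (u x)

/-- `w` minimizes the functional `F` over `L²(Ω)`. -/
def IsMinimizerL2 (Ω : Set Plane) (F : (Plane → ℝ) → ℝ≥0∞) (w : Plane → ℝ) : Prop :=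
  MemLp w 2 (volume.restrict Ω) ∧
    ∀ u : Plane → ℝ, MemLp u 2 (volume.restrict Ω) → F w ≤ F u

end AnisoCV

end

/-!
The proof replaces the coarea formula by convex duality and a truncation argument.

Put `s = (c₁ + c₂) / 2`, `lam = 2 μ (c₁ - c₂)` and `p = lam (f - w)`. Minimality of `w` says that
`p` is a subgradient of the one-homogeneous functional `|D·|₁(Ω)` at `w`: `∫ p v ≤ |Dv|₁(Ω)` for all
`v` (`integral_mul_le_totalVariation`), with equality at `v = w`
(`totalVariation_le_integral_mul`).
Suppose that the characteristic function `χ` of `{w > s}` also satisfies `|Dχ|₁(Ω) ≤ ∫ p χ`. Up to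
a constant, the second term of `relaxedG` at `u` with values in `[0, 1]` is `lam ∫ (s - f) u`. Since
`p + lam (s - f) = lam (s - w)`, the functional is then at most `lam ∫ (s - w) χ` at `χ` and at
least `lam ∫ (s - w) u` at `u`, and `χ` minimizes `lam ∫ (s - w) u` pointwise.

To pass from `w` to `χ`, let `h` be smooth, bounded, with `0 ≤ h' ≤ 1`. Total variation splits:
`|D(h ∘ w)| + |D(w - h ∘ w)| ≤ |Dw|` (`integral_truncation_add_integral_remainder_le`). Both
summands on the left are bounded below by their integrals against `p`, and these add up to
`∫ p w = |Dw|`; hence `|D(h ∘ w)| ≤ ∫ p (h ∘ w)` (`integral_comp_mul_divergence_le`). This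
inequality is homogeneous in `h`, so any bound on `h'` will do, and letting `h` increase to the
indicator of `(s, ∞)` gives it for `χ` (`integral_superlevel_mul_divergence_le`).

The splitting needs no approximation of `w` up to the boundary of `Ω`. For smooth `v` and admissible
fields `η`, `ξ`, integration by parts gives
`∫ (h ∘ v) div η + ∫ (v - h ∘ v) div ξ = ∫ v div ζ` with `ζ = (h' ∘ v) η + (1 - h' ∘ v) ξ`
(`integral_split_eq`), and `ζ` is again admissible because the constraint on fields is convex.
When `v` is a mollification of `w`, the right side is an average of the integrals of `w` against the
divergences of translates of `ζ`, which are admissible for small translations since `ζ` is supported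
in a fixed compact subset of `Ω`; so it is at most `|Dw|₁(Ω)`.
-/

namespace AnisoCV

open Filter Topology Convolution

/-! ### Divergence of compactly supported fields -/

lemma divergence_eq {η : Plane → Plane} (x : Plane) :
    divergence η x = ∑ i : Fin 2,
      EuclideanSpace.proj (𝕜 := ℝ) i (fderiv ℝ η x (EuclideanSpace.single i 1)) := rfl

lemma continuous_divergence {η : Plane → Plane} (hη : ContDiff ℝ 1 η) :
    Continuous (divergence η) := by
  have h : Continuous (fderiv ℝ η) := hη.continuous_fderiv one_ne_zero
  have : divergence η = fun x => ∑ i : Fin 2,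
      EuclideanSpace.proj (𝕜 := ℝ) i (fderiv ℝ η x (EuclideanSpace.single i 1)) := rfl
  rw [this]
  fun_prop

lemma tsupport_divergence_subset (η : Plane → Plane) :
    tsupport (divergence η) ⊆ tsupport η := by
  refine closure_minimal ?_ (isClosed_tsupport η)
  intro x hx
  by_contra hxn
  apply hx
  have : fderiv ℝ η x = 0 := by
    by_contra h
    exact hxn (support_fderiv_subset ℝ h)
  simp [divergence, this]

lemma divergence_eq_zero_of_notMem {η : Plane → Plane} {x : Plane} (hx : x ∉ tsupport η) :
    divergence η x = 0 :=
  image_eq_zero_of_notMem_tsupport fun h => hx (tsupport_divergence_subset η h)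

lemma hasCompactSupport_divergence {η : Plane → Plane} (hη : HasCompactSupport η) :
    HasCompactSupport (divergence η) :=
  hη.of_isClosed_subset (isClosed_tsupport _) (tsupport_divergence_subset η)

lemma integrable_divergence {η : Plane → Plane} (hη : ContDiff ℝ 1 η)
    (hc : HasCompactSupport η) : Integrable (divergence η) :=
  (continuous_divergence hη).integrable_of_hasCompactSupport (hasCompactSupport_divergence hc)

lemma divergence_comp_add_right (η : Plane → Plane) (t x : Plane) :
    divergence (fun y => η (y + t)) x = divergence η (x + t) := by
  simp [divergence, fderiv_comp_add_right]

lemma divergence_add {η ξ : Plane → Plane} {x : Plane} (hη : DifferentiableAt ℝ η x)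
    (hξ : DifferentiableAt ℝ ξ x) :
    divergence (fun y => η y + ξ y) x = divergence η x + divergence ξ x := by
  simp only [divergence, fderiv_fun_add hη hξ, Fin.sum_univ_two]
  simp
  ring

lemma divergence_smul {a : Plane → ℝ} {η : Plane → Plane} {x : Plane}
    (ha : DifferentiableAt ℝ a x) (hη : DifferentiableAt ℝ η x) :
    divergence (fun y => a y • η y) x = a x * divergence η x
      + ∑ i : Fin 2, fderiv ℝ a x (EuclideanSpace.single i 1) * η x i := by
  simp only [divergence, fderiv_fun_smul ha hη, Fin.sum_univ_two]
  simp
  ring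

/-- The divergence theorem for compactly supported fields. -/
lemma integral_divergence_eq_zero {η : Plane → Plane} (hη : ContDiff ℝ 1 η)
    (hc : HasCompactSupport η) : ∫ x, divergence η x = 0 := by
  have hd : Continuous (fderiv ℝ η) := hη.continuous_fderiv one_ne_zero
  have hint (i : Fin 2) : Integrable (fun x => fderiv ℝ η x (EuclideanSpace.single i 1)) :=
    (by fun_prop : Continuous fun x => fderiv ℝ η x (EuclideanSpace.single i 1)
      ).integrable_of_hasCompactSupport (hc.fderiv_apply ℝ _)
  have hzero (i : Fin 2) : ∫ x, fderiv ℝ η x (EuclideanSpace.single i 1) = 0 := by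
    have := integral_smul_fderiv_eq_neg_fderiv_smul_of_integrable (𝕜 := ℝ)
      (μ := (volume : Measure Plane)) (f := fun _ => (1 : ℝ)) (g := η)
      (v := EuclideanSpace.single i 1) (by simp) (by simpa using hint i)
      (by simpa using hη.continuous.integrable_of_hasCompactSupport hc)
      (by simp) (fun x _ => (hη.differentiable one_ne_zero).differentiableAt)
    simpa using this
  simp only [divergence_eq]
  rw [integral_finsetSum _ fun i _ => ContinuousLinearMap.integrable_comp _ (hint i)]
  refine Finset.sum_eq_zero fun i _ => ?_
  rw [ContinuousLinearMap.integral_comp_comm _ (hint i), hzero, map_zero]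

lemma tsupport_smul_add_smul_subset (η ξ : Plane → Plane) (a b : Plane → ℝ) :
    tsupport (fun x => a x • η x + b x • ξ x) ⊆ tsupport η ∪ tsupport ξ := by
  refine closure_minimal ?_ ((isClosed_tsupport η).union (isClosed_tsupport ξ))
  intro x hx
  by_contra hn
  rw [mem_union, not_or] at hn
  apply hx
  simp [image_eq_zero_of_notMem_tsupport hn.1, image_eq_zero_of_notMem_tsupport hn.2]

lemma _root_.HasCompactSupport.smul_add_smul {η ξ : Plane → Plane} (hη : HasCompactSupport η)
    (hξ : HasCompactSupport ξ) (a b : Plane → ℝ) :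
    HasCompactSupport fun x => a x • η x + b x • ξ x :=
  (hη.isCompact.union hξ.isCompact).of_isClosed_subset (isClosed_tsupport _)
    (tsupport_smul_add_smul_subset η ξ a b)

/-! ### Admissible fields -/

variable {φ : Plane → ℝ} {Ω : Set Plane}

/-- A convex combination, with `C¹` coefficients depending on the point, of two admissible fields
is admissible. -/
lemma IsTestField.convexCombination {η ξ : Plane → Plane} {a : Plane → ℝ}
    (hη : IsTestField φ Ω η) (hξ : IsTestField φ Ω ξ) (ha : ContDiff ℝ 1 a)
    (h0 : ∀ x, 0 ≤ a x) (h1 : ∀ x, a x ≤ 1) :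
    IsTestField φ Ω (fun x => a x • η x + (1 - a x) • ξ x) := by
  refine ⟨?_, ?_, (tsupport_smul_add_smul_subset η ξ _ _).trans
    (union_subset hη.tsupport_subset hξ.tsupport_subset), ?_⟩
  · have := hη.contDiff
    have := hξ.contDiff
    fun_prop
  · exact hη.hasCompactSupport.smul_add_smul hξ.hasCompactSupport _ _
  · intro x v
    rw [inner_add_left, real_inner_smul_left, real_inner_smul_left]
    nlinarith [mul_le_mul_of_nonneg_left (hη.dual_le x v) (h0 x),
      mul_le_mul_of_nonneg_left (hξ.dual_le x v) (sub_nonneg.2 (h1 x))]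

/-- A translate of an admissible field is admissible as long as its support stays in `Ω`. -/
lemma IsTestField.translate {η : Plane → Plane} (hη : IsTestField φ Ω η) {δ : ℝ} {t : Plane}
    (hδ : Metric.cthickening δ (tsupport η) ⊆ Ω) (ht : ‖t‖ ≤ δ) :
    IsTestField φ Ω (fun x => η (x + t)) := by
  have hts : tsupport (fun x => η (x + t)) = (fun x => x + t) ⁻¹' tsupport η :=
    tsupport_comp_eq_preimage η (Homeomorph.addRight t)
  refine ⟨by have := hη.contDiff; fun_prop,
    hη.hasCompactSupport.comp_homeomorph (Homeomorph.addRight t), ?_, fun x => hη.dual_le _⟩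
  rw [hts]
  intro x hx
  exact hδ (Metric.mem_cthickening_of_dist_le x (x + t) δ _ hx (by simpa using ht))

/-! ### Mollification -/

/-- Integrating a mollification against a test function averages the integrals against the
translates of that test function. -/
lemma integral_convolution_mul {ρ W g : Plane → ℝ} (hρ : Integrable ρ) (hW : Integrable W)
    (hg : Continuous g) (hgc : HasCompactSupport g) :
    ∫ x, (ρ ⋆[ContinuousLinearMap.lsmul ℝ ℝ, volume] W) x * g x
      = ∫ t, ρ t * ∫ x, W x * g (x + t) := by
  obtain ⟨C, hC⟩ := hg.bounded_above_of_compact_support hgc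
  have hint : Integrable (fun p : Plane × Plane => ρ p.2 * W (p.1 - p.2) * g p.1)
      (volume.prod volume) := by
    have h := hρ.convolution_integrand (ContinuousLinearMap.lsmul ℝ ℝ) hW
    refine (h.bdd_mul (f := fun p : Plane × Plane => g p.1) (c := C)
      (hg.comp continuous_fst).aestronglyMeasurable (.of_forall fun p => hC _)).congr ?_
    exact .of_forall fun p => by simp [mul_comm]
  calc ∫ x, (ρ ⋆[ContinuousLinearMap.lsmul ℝ ℝ, volume] W) x * g x
      = ∫ x, ∫ t, ρ t * W (x - t) * g x := by
        congr 1 with x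
        rw [integral_mul_const]
        rfl
    _ = ∫ t, ∫ x, ρ t * W (x - t) * g x := integral_integral_swap hint
    _ = ∫ t, ρ t * ∫ x, W x * g (x + t) := by
        congr 1 with t
        rw [← integral_const_mul, ← integral_add_right_eq_self _ t]
        simp [mul_assoc]

lemma continuous_integral_mul_translate {W g : Plane → ℝ} (hW : Integrable W)
    (hg : Continuous g) (hgc : HasCompactSupport g) :
    Continuous fun t : Plane => ∫ x, W x * g (x + t) := by
  obtain ⟨C, hC⟩ := hg.bounded_above_of_compact_support hgc
  refine continuous_of_dominated (bound := fun x => ‖W x‖ * C) ?_ ?_ (hW.norm.mul_const C) ?_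
  · intro t
    exact hW.1.mul (by fun_prop : Continuous fun x => g (x + t)).aestronglyMeasurable
  · intro t
    refine .of_forall fun x => ?_
    rw [norm_mul]
    gcongr
    exact hC _
  · exact .of_forall fun x => by fun_prop

/-- Mollifications converge weakly against continuous compactly supported functions. -/
lemma tendsto_integral_convolution_mul {ρ : ℕ → ContDiffBump (0 : Plane)}
    (hρ : Tendsto (fun n => (ρ n).rOut) atTop (𝓝 0)) {W g : Plane → ℝ} (hW : Integrable W)
    (hg : Continuous g) (hgc : HasCompactSupport g) :
    Tendsto (fun n => ∫ x,
      ((ρ n).normed volume ⋆[ContinuousLinearMap.lsmul ℝ ℝ, volume] W) x * g x) atTop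
      (𝓝 (∫ x, W x * g x)) := by
  have hG := (continuous_integral_mul_translate hW hg hgc).comp continuous_neg
  have := ContDiffBump.convolution_tendsto_right_of_continuous (μ := (volume : Measure Plane))
    hρ hG 0
  simp only [Function.comp_apply, neg_zero, add_zero] at this
  refine this.congr fun n => ?_
  rw [integral_convolution_mul (ρ n).integrable_normed hW hg hgc]
  simp [convolution]

/-- Mollification at a scale that keeps the translates of `η` inside `Ω` preserves the bound on the
integral against `div η`: the new integral is an average over those translates. -/
lemma integral_convolution_mul_divergence_le {ρ : ContDiffBump (0 : Plane)} {W : Plane → ℝ}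
    (hW : Integrable W) {M : ℝ}
    (hM : ∀ η, IsTestField φ Ω η → ∫ x, W x * divergence η x ≤ M)
    {η : Plane → Plane} (hη : IsTestField φ Ω η)
    (hδ : Metric.cthickening ρ.rOut (tsupport η) ⊆ Ω) :
    ∫ x, (ρ.normed volume ⋆[ContinuousLinearMap.lsmul ℝ ℝ, volume] W) x * divergence η x ≤ M := by
  have hc := continuous_divergence hη.contDiff
  have hcs := hasCompactSupport_divergence hη.hasCompactSupport
  rw [integral_convolution_mul ρ.integrable_normed hW hc hcs]
  calc ∫ t, ρ.normed volume t * ∫ x, W x * divergence η (x + t)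
      ≤ ∫ t, ρ.normed volume t * M := by
        refine integral_mono ?_ (ρ.integrable_normed.mul_const M) fun t => ?_
        · exact (ρ.continuous_normed.mul (continuous_integral_mul_translate hW hc hcs)
            ).integrable_of_hasCompactSupport ρ.hasCompactSupport_normed.mul_right
        · by_cases ht : t ∈ tsupport (ρ.normed volume)
          · rw [ρ.tsupport_normed_eq, mem_closedBall_zero_iff] at ht
            have := hM _ (hη.translate hδ ht)
            simp only [divergence_comp_add_right] at this
            exact mul_le_mul_of_nonneg_left this (ρ.nonneg_normed t)
          · simp [image_eq_zero_of_notMem_tsupport ht]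
    _ = M := by rw [integral_mul_const, ρ.integral_normed, one_mul]

/-! ### Splitting along a truncation -/

/-- The pointwise identity behind `integral_split_eq`: the terms containing derivatives of `v`
cancel by the chain rule, so the three products with divergences add up to a divergence. -/
lemma divergence_split {v : Plane → ℝ} {h : ℝ → ℝ} {η ξ ζ : Plane → Plane} {x : Plane}
    (dv : DifferentiableAt ℝ v x) (dh : DifferentiableAt ℝ h (v x))
    (dη : DifferentiableAt ℝ η x) (dξ : DifferentiableAt ℝ ξ x) (dζ : DifferentiableAt ℝ ζ x)
    (hζ : ζ x = deriv h (v x) • η x + (1 - deriv h (v x)) • ξ x) :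
    divergence (fun y => (h (v y) • η y + (v y - h (v y)) • ξ y) + (- v y) • ζ y) x
      = h (v x) * divergence η x + v x * divergence ξ x
        - h (v x) * divergence ξ x - v x * divergence ζ x := by
  have dhv : DifferentiableAt ℝ (fun y => h (v y)) x := dh.comp x dv
  have fhv : fderiv ℝ (fun y => h (v y)) x = deriv h (v x) • fderiv ℝ v x :=
    (dh.hasDerivAt.comp_hasFDerivAt x dv.hasFDerivAt).fderiv
  rw [divergence_add ((dhv.fun_smul dη).fun_add ((dv.fun_sub dhv).fun_smul dξ))
      (dv.fun_neg.fun_smul dζ), divergence_add (dhv.fun_smul dη) ((dv.fun_sub dhv).fun_smul dξ),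
    divergence_smul dhv dη, divergence_smul (dv.fun_sub dhv) dξ,
    divergence_smul dv.fun_neg dζ, fderiv_fun_sub dv dhv, fderiv_fun_neg, fhv, hζ]
  simp only [Fin.sum_univ_two, _root_.sub_apply, _root_.neg_apply,
    _root_.smul_apply, smul_eq_mul, PiLp.add_apply, PiLp.smul_apply]
  ring

/-- Splitting a `C¹` function `v` as `h ∘ v + (v - h ∘ v)` and testing the two parts with
different fields amounts to testing `v` with the combination of the two fields with weights
`h' ∘ v` and `1 - h' ∘ v`. -/
lemma integral_split_eq {v : Plane → ℝ} (hv : ContDiff ℝ 1 v) {h : ℝ → ℝ} (hh : ContDiff ℝ 2 h)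
    {η ξ : Plane → Plane} (hη : ContDiff ℝ 1 η) (hξ : ContDiff ℝ 1 ξ)
    (hηc : HasCompactSupport η) (hξc : HasCompactSupport ξ) :
    (∫ x, h (v x) * divergence η x) + (∫ x, v x * divergence ξ x)
      - (∫ x, h (v x) * divergence ξ x)
      = ∫ x, v x * divergence
          (fun y => deriv h (v y) • η y + (1 - deriv h (v y)) • ξ y) x := by
  have hh1 : ContDiff ℝ 1 h := hh.of_le (by norm_num)
  have hh' : ContDiff ℝ 1 (deriv h) :=
    (contDiff_succ_iff_deriv.1
      (show ContDiff ℝ (1 + 1) h by simpa [one_add_one_eq_two] using hh)).2.2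
  set ζ : Plane → Plane := fun y => deriv h (v y) • η y + (1 - deriv h (v y)) • ξ y with hζ
  have hζd : ContDiff ℝ 1 ζ := by fun_prop
  have hS (a b : Plane → ℝ) : HasCompactSupport fun y => a y • η y + b y • ξ y :=
    hηc.smul_add_smul hξc a b
  have hζc : HasCompactSupport ζ := hS _ _
  have hI {a : Plane → ℝ} (ha : Continuous a) {θ : Plane → Plane} (hθ : ContDiff ℝ 1 θ)
      (hθc : HasCompactSupport θ) : Integrable fun x => a x * divergence θ x :=
    (ha.mul (continuous_divergence hθ)).integrable_of_hasCompactSupport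
      (hasCompactSupport_divergence hθc).mul_left
  have hhv : Continuous fun x => h (v x) := hh1.continuous.comp hv.continuous
  set F : Plane → Plane := fun y => (h (v y) • η y + (v y - h (v y)) • ξ y) + (- v y) • ζ y
  have hFd : ContDiff ℝ 1 F := by fun_prop
  have hFc : HasCompactSupport F := by
    have := (hS (fun y => h (v y)) fun y => v y - h (v y)).smul_add_smul hζc (fun _ => 1)
      fun y => - v y
    simpa only [one_smul] using this
  have key (x : Plane) : divergence F x = h (v x) * divergence η x + v x * divergence ξ x
      - h (v x) * divergence ξ x - v x * divergence ζ x :=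
    divergence_split (hv.differentiable one_ne_zero x) (hh1.differentiable one_ne_zero _)
      (hη.differentiable one_ne_zero x) (hξ.differentiable one_ne_zero x)
      (hζd.differentiable one_ne_zero x) rfl
  have hz := integral_divergence_eq_zero hFd hFc
  simp only [key] at hz
  rw [integral_sub, integral_sub, integral_add] at hz
  · linarith
  · exact hI hhv hη hηc
  · exact hI hv.continuous hξ hξc
  · exact (hI hhv hη hηc).add (hI hv.continuous hξ hξc)
  · exact hI hhv hξ hξc
  · exact ((hI hhv hη hηc).add (hI hv.continuous hξ hξc)).sub (hI hhv hξ hξc)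
  · exact hI hv.continuous hζd hζc

/-- **Total variation splits along monotone Lipschitz truncations.** If `0 ≤ h' ≤ 1`, testing
`h ∘ w` and `w - h ∘ w` with two independent fields gives at most the total variation of `w`.
For smooth `w` this is `integral_split_eq`, since the combined field is admissible; the general
case follows by mollification, only the translates of the fields having to stay inside `Ω`. -/
lemma integral_truncation_add_integral_remainder_le (hΩ : IsOpen Ω) {w : Plane → ℝ}
    (hw : IntegrableOn w Ω) {M : ℝ}
    (hM : ∀ η, IsTestField φ Ω η → ∫ x in Ω, w x * divergence η x ≤ M)
    {h : ℝ → ℝ} (hh : ContDiff ℝ 2 h) (h0 : ∀ s, 0 ≤ deriv h s) (h1 : ∀ s, deriv h s ≤ 1)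
    {B : ℝ} (hB : ∀ s, |h s| ≤ B) {η ξ : Plane → Plane}
    (hη : IsTestField φ Ω η) (hξ : IsTestField φ Ω ξ) :
    (∫ x in Ω, h (w x) * divergence η x) + ∫ x in Ω, (w x - h (w x)) * divergence ξ x ≤ M := by
  set W : Plane → ℝ := Ω.indicator w with hWdef
  have hW : Integrable W := hw.integrable_indicator hΩ.measurableSet
  have hWΩ {x : Plane} (hx : x ∈ Ω) : W x = w x := indicator_of_mem hx w
  -- Fields supported in `Ω` do not see the extension by zero.
  have hext {θ : Plane → Plane} (hθ : IsTestField φ Ω θ) (k : ℝ → ℝ) :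
      ∫ x in Ω, k (w x) * divergence θ x = ∫ x, k (W x) * divergence θ x := by
    rw [← setIntegral_eq_integral_of_forall_compl_eq_zero (s := Ω)
      (f := fun x => k (W x) * divergence θ x)]
    · exact setIntegral_congr_fun hΩ.measurableSet fun x hx => by simp only [hWΩ hx]
    · intro x hx
      rw [divergence_eq_zero_of_notMem fun hx' => hx (hθ.tsupport_subset hx'), mul_zero]
  have hMW (θ : Plane → Plane) (hθ : IsTestField φ Ω θ) : ∫ x, W x * divergence θ x ≤ M :=
    (hext hθ id).symm.le.trans (hM θ hθ)
  obtain ⟨δ, hδ, hδΩ⟩ := (hη.hasCompactSupport.isCompact.union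
    hξ.hasCompactSupport.isCompact).exists_cthickening_subset_open hΩ
    (union_subset hη.tsupport_subset hξ.tsupport_subset)
  let ρ (n : ℕ) : ContDiffBump (0 : Plane) :=
    ⟨1 / ((n : ℝ) + 1), 2 * (1 / ((n : ℝ) + 1)), by positivity,
      by have : 0 < 1 / ((n : ℝ) + 1) := by positivity
         linarith⟩
  have hρ : Tendsto (fun n => (ρ n).rOut) atTop (𝓝 0) := by
    simpa [ρ] using (tendsto_one_div_add_atTop_nhds_zero_nat (𝕜 := ℝ)).const_mul 2
  set v : ℕ → Plane → ℝ := fun n =>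
    (ρ n).normed volume ⋆[ContinuousLinearMap.lsmul ℝ ℝ, volume] W with hv
  have hvd (n : ℕ) : ContDiff ℝ 1 (v n) :=
    (ρ n).hasCompactSupport_normed.contDiff_convolution_left (n := 1)
      (ContinuousLinearMap.lsmul ℝ ℝ) (ρ n).contDiff_normed hW.locallyIntegrable
  have hae : ∀ᵐ x, Tendsto (fun n => v n x) atTop (𝓝 (W x)) :=
    ContDiffBump.ae_convolution_tendsto_right_of_locallyIntegrable (K := 2) hρ
      (.of_forall fun n => le_rfl) hW.locallyIntegrable
  have hhc : Continuous h := hh.continuous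
  have hh1 : ContDiff ℝ 1 h := hh.of_le (by norm_num)
  have hh' : ContDiff ℝ 1 (deriv h) :=
    (contDiff_succ_iff_deriv.1
      (show ContDiff ℝ (1 + 1) h by simpa [one_add_one_eq_two] using hh)).2.2
  have hlim {θ : Plane → Plane} (hθ : IsTestField φ Ω θ) :
      Tendsto (fun n => ∫ x, h (v n x) * divergence θ x) atTop
        (𝓝 (∫ x, h (W x) * divergence θ x)) := by
    refine tendsto_integral_of_dominated_convergence (fun x => B * ‖divergence θ x‖) ?_ ?_ ?_ ?_
    · exact fun n => ((hhc.comp (hvd n).continuous).mul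
        (continuous_divergence hθ.contDiff)).aestronglyMeasurable
    · exact (integrable_divergence hθ.contDiff hθ.hasCompactSupport).norm.const_mul B
    · intro n
      refine .of_forall fun x => ?_
      rw [norm_mul]
      gcongr
      exact hB _
    · filter_upwards [hae] with x hx
      exact ((hhc.tendsto _).comp hx).mul_const _
  have hlim' : Tendsto (fun n => ∫ x, v n x * divergence ξ x) atTop
      (𝓝 (∫ x, W x * divergence ξ x)) :=
    tendsto_integral_convolution_mul hρ hW (continuous_divergence hξ.contDiff)
      (hasCompactSupport_divergence hξ.hasCompactSupport)
  have hle : ∀ᶠ n in atTop, (∫ x, h (v n x) * divergence η x) + (∫ x, v n x * divergence ξ x)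
      - (∫ x, h (v n x) * divergence ξ x) ≤ M := by
    filter_upwards [hρ.eventually (ge_mem_nhds hδ)] with n hn
    rw [integral_split_eq (hvd n) hh hη.contDiff hξ.contDiff hη.hasCompactSupport
      hξ.hasCompactSupport]
    refine integral_convolution_mul_divergence_le hW hMW
      (hη.convexCombination hξ (hh'.comp (hvd n)) (fun x => h0 _) fun x => h1 _) ?_
    refine Subset.trans ?_ hδΩ
    exact (Metric.cthickening_mono hn _).trans
      (Metric.cthickening_subset_of_subset _ (tsupport_smul_add_smul_subset η ξ _ _))
  have hfin := le_of_tendsto (((hlim hη).add hlim').sub (hlim hξ)) hle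
  have hbdd : Integrable fun x => h (W x) * divergence ξ x :=
    (integrable_divergence hξ.contDiff hξ.hasCompactSupport).bdd_mul (c := B)
      (hhc.comp_aestronglyMeasurable hW.1) (.of_forall fun x => hB _)
  obtain ⟨C, hC⟩ := (continuous_divergence hξ.contDiff).bounded_above_of_compact_support
    (hasCompactSupport_divergence hξ.hasCompactSupport)
  have hbdd' : Integrable fun x => W x * divergence ξ x :=
    hW.mul_bdd (c := C) (continuous_divergence hξ.contDiff).aestronglyMeasurable (.of_forall hC)
  rw [hext hη h, hext hξ fun s => s - h s]
  simp only [sub_mul]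
  rw [integral_sub hbdd' hbdd]
  linarith

/-! ### Subgradients of the total variation and super-level sets -/

lemma totalVariation_le {u : Plane → ℝ} {M : ℝ}
    (hM : ∀ η, IsTestField φ Ω η → ∫ x in Ω, u x * divergence η x ≤ M) :
    totalVariation φ Ω u ≤ ENNReal.ofReal M :=
  iSup₂_le fun η hη => ENNReal.ofReal_le_ofReal (hM η hη)

lemma integral_mul_divergence_le {u : Plane → ℝ} (hu : totalVariation φ Ω u ≠ ∞)
    {η : Plane → Plane} (hη : IsTestField φ Ω η) :
    ∫ x in Ω, u x * divergence η x ≤ (totalVariation φ Ω u).toReal :=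
  (ENNReal.ofReal_le_iff_le_toReal hu).1 <|
    le_iSup₂ (f := fun (η : Plane → Plane) (_ : IsTestField φ Ω η) =>
      ENNReal.ofReal (∫ x in Ω, u x * divergence η x)) η hη

lemma isTestField_zero (hφ : ∀ v, 0 ≤ φ v) : IsTestField φ Ω 0 :=
  ⟨contDiff_const, HasCompactSupport.zero, by simp [tsupport], fun x v => by simpa using hφ v⟩

lemma l1_nonneg (v : Plane) : 0 ≤ l1 v := add_nonneg (abs_nonneg _) (abs_nonneg _)

lemma integrable_mul_divergence {u : Plane → ℝ} (hu : IntegrableOn u Ω)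
    {η : Plane → Plane} (hη : IsTestField φ Ω η) :
    IntegrableOn (fun x => u x * divergence η x) Ω := by
  obtain ⟨C, hC⟩ := (continuous_divergence hη.contDiff).bounded_above_of_compact_support
    (hasCompactSupport_divergence hη.hasCompactSupport)
  exact Integrable.mul_bdd (c := C) hu
    (continuous_divergence hη.contDiff).aestronglyMeasurable (.of_forall hC)

/-- If `p` is a subgradient of the total variation at `w`, then the inequality
`|Du|(Ω) ≤ ∫ p u` holds for `u = h ∘ w` with `h` smooth, bounded and nondecreasing. -/
lemma integral_comp_mul_divergence_le (hφ : ∀ v, 0 ≤ φ v) (hΩ : IsOpen Ω)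
    [IsFiniteMeasure (volume.restrict Ω)] {w p : Plane → ℝ}
    (hw : MemLp w 2 (volume.restrict Ω)) (hp : MemLp p 2 (volume.restrict Ω))
    (hwTV : totalVariation φ Ω w ≠ ∞)
    (hsub : ∀ v, MemLp v 2 (volume.restrict Ω) → totalVariation φ Ω v ≠ ∞ →
      ∫ x in Ω, p x * v x ≤ (totalVariation φ Ω v).toReal)
    (heq : (totalVariation φ Ω w).toReal ≤ ∫ x in Ω, p x * w x)
    {h : ℝ → ℝ} (hh : ContDiff ℝ 2 h) (h0 : ∀ s, 0 ≤ deriv h s) {C : ℝ}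
    (hC : ∀ s, deriv h s ≤ C) {B : ℝ} (hB : ∀ s, |h s| ≤ B) {η : Plane → Plane}
    (hη : IsTestField φ Ω η) :
    ∫ x in Ω, h (w x) * divergence η x ≤ ∫ x in Ω, p x * h (w x) := by
  -- Rescaling by `D > 0` turns `h` into a function with slope at most one.
  obtain ⟨D, hD, hCD⟩ : ∃ D : ℝ, 0 < D ∧ C ≤ D := ⟨max C 1, by positivity, le_max_left _ _⟩
  set k : ℝ → ℝ := fun s => D⁻¹ * h s with hk
  have hkd : ContDiff ℝ 2 k := by fun_prop
  have hderiv (s : ℝ) : deriv k s = D⁻¹ * deriv h s :=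
    deriv_const_mul _ (hh.differentiable two_ne_zero s)
  have hk0 (s : ℝ) : 0 ≤ deriv k s := by
    rw [hderiv]
    exact mul_nonneg (inv_nonneg.2 hD.le) (h0 s)
  have hk1 (s : ℝ) : deriv k s ≤ 1 := by
    rw [hderiv, inv_mul_le_one₀ hD]
    exact (hC s).trans hCD
  have hkB (s : ℝ) : |k s| ≤ D⁻¹ * B := by
    rw [hk, abs_mul, abs_of_pos (inv_pos.2 hD)]
    exact mul_le_mul_of_nonneg_left (hB s) (inv_nonneg.2 hD.le)
  have hkw : MemLp (fun x => k (w x)) 2 (volume.restrict Ω) :=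
    MemLp.of_bound (hkd.continuous.comp_aestronglyMeasurable hw.1) _ (.of_forall fun x => hkB _)
  have hwi : IntegrableOn w Ω := hw.integrable one_le_two
  have hsplit {ξ : Plane → Plane} (hξ : IsTestField φ Ω ξ) :
      ∫ x in Ω, (w x - k (w x)) * divergence ξ x
        ≤ (totalVariation φ Ω w).toReal - ∫ x in Ω, k (w x) * divergence η x := by
    have := integral_truncation_add_integral_remainder_le hΩ hwi
      (fun θ hθ => integral_mul_divergence_le hwTV hθ) hkd hk0 hk1 hkB hη hξ
    linarith
  have hnonneg : 0 ≤ (totalVariation φ Ω w).toReal - ∫ x in Ω, k (w x) * divergence η x := by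
    simpa [divergence] using hsplit (isTestField_zero hφ)
  have hTV := totalVariation_le (u := fun x => w x - k (w x)) fun ξ hξ => hsplit hξ
  have hpk := hsub (fun x => w x - k (w x)) (hw.sub hkw)
    (ne_top_of_le_ne_top ENNReal.ofReal_ne_top hTV)
  have hle := hpk.trans (ENNReal.toReal_le_of_le_ofReal hnonneg hTV)
  have hpw : IntegrableOn (fun x => p x * w x) Ω := hp.integrable_mul hw
  have hpkw : IntegrableOn (fun x => p x * k (w x)) Ω := hp.integrable_mul hkw
  simp only [mul_sub] at hle
  rw [integral_sub hpw hpkw] at hle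
  have hscaled : ∫ x in Ω, k (w x) * divergence η x ≤ ∫ x in Ω, p x * k (w x) := by linarith
  simp only [hk, mul_assoc, mul_left_comm _ D⁻¹] at hscaled
  rw [integral_const_mul, integral_const_mul] at hscaled
  exact le_of_mul_le_mul_left hscaled (inv_pos.2 hD)

lemma smoothTransition_deriv_nonneg (s : ℝ) : 0 ≤ deriv Real.smoothTransition s :=
  Real.smoothTransition.monotone.deriv_nonneg

lemma exists_deriv_smoothTransition_le : ∃ C, ∀ s, deriv Real.smoothTransition s ≤ C := by
  have hc : Continuous (deriv Real.smoothTransition) :=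
    (Real.smoothTransition.contDiff (n := 1)).continuous_deriv_one
  have hs : HasCompactSupport (deriv Real.smoothTransition) := by
    refine HasCompactSupport.intro (isCompact_Icc (a := (0 : ℝ)) (b := 1)) fun x hx => ?_
    rcases not_and_or.1 hx with hx | hx
    · have : Real.smoothTransition =ᶠ[𝓝 x] fun _ => (0 : ℝ) := by
        filter_upwards [Iio_mem_nhds (not_le.1 hx)] with y hy
        exact Real.smoothTransition.zero_of_nonpos (le_of_lt hy)
      rw [this.deriv_eq, deriv_const]
    · have : Real.smoothTransition =ᶠ[𝓝 x] fun _ => (1 : ℝ) := by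
        filter_upwards [Ioi_mem_nhds (not_le.1 hx)] with y hy
        exact Real.smoothTransition.one_of_one_le (le_of_lt hy)
      rw [this.deriv_eq, deriv_const]
  obtain ⟨C, hC⟩ := hc.bounded_above_of_compact_support hs
  exact ⟨C, fun s => (le_abs_self _).trans (hC s)⟩

lemma tendsto_smoothTransition_indicator (s t : ℝ) :
    Tendsto (fun n : ℕ => Real.smoothTransition (n * (t - s))) atTop
      (𝓝 ((Ioi s).indicator (fun _ => (1 : ℝ)) t)) := by
  by_cases ht : s < t
  · rw [indicator_of_mem (mem_Ioi.2 ht)]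
    refine tendsto_const_nhds.congr' ?_
    filter_upwards [(tendsto_natCast_atTop_atTop.atTop_mul_const
      (sub_pos.2 ht)).eventually_ge_atTop 1] with n hn
    exact (Real.smoothTransition.one_of_one_le hn).symm
  · rw [indicator_of_notMem (by simpa using ht)]
    refine tendsto_const_nhds.congr fun n => ?_
    exact (Real.smoothTransition.zero_of_nonpos
      (mul_nonpos_of_nonneg_of_nonpos n.cast_nonneg (by linarith))).symm

/-- If `p` is a subgradient of the total variation at `w`, then it is also one at every
super-level set of `w`. -/
lemma integral_superlevel_mul_divergence_le (hφ : ∀ v, 0 ≤ φ v) (hΩ : IsOpen Ω)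
    [IsFiniteMeasure (volume.restrict Ω)] {w p : Plane → ℝ}
    (hw : MemLp w 2 (volume.restrict Ω)) (hp : MemLp p 2 (volume.restrict Ω))
    (hwTV : totalVariation φ Ω w ≠ ∞)
    (hsub : ∀ v, MemLp v 2 (volume.restrict Ω) → totalVariation φ Ω v ≠ ∞ →
      ∫ x in Ω, p x * v x ≤ (totalVariation φ Ω v).toReal)
    (heq : (totalVariation φ Ω w).toReal ≤ ∫ x in Ω, p x * w x) (s : ℝ)
    {η : Plane → Plane} (hη : IsTestField φ Ω η) :
    ∫ x in Ω, (Ioi s).indicator (fun _ => (1 : ℝ)) (w x) * divergence η x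
      ≤ ∫ x in Ω, p x * (Ioi s).indicator (fun _ => (1 : ℝ)) (w x) := by
  obtain ⟨C, hC⟩ := exists_deriv_smoothTransition_le
  set h : ℕ → ℝ → ℝ := fun n t => Real.smoothTransition (n * (t - s)) with hh
  have hST : ContDiff ℝ 2 Real.smoothTransition := Real.smoothTransition.contDiff (n := 2)
  have hd (n : ℕ) : ContDiff ℝ 2 (h n) := by fun_prop
  have hderiv (n : ℕ) (t : ℝ) :
      deriv (h n) t = n * deriv Real.smoothTransition (n * (t - s)) := by
    have h1 : HasDerivAt (fun t : ℝ => (n : ℝ) * (t - s)) n t := by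
      simpa using ((hasDerivAt_id t).sub_const s).const_mul (n : ℝ)
    rw [mul_comm]
    exact ((hST.differentiable two_ne_zero _).hasDerivAt.comp t h1).deriv
  have hB (n : ℕ) (t : ℝ) : |h n t| ≤ 1 := by
    rw [abs_of_nonneg (Real.smoothTransition.nonneg _)]
    exact Real.smoothTransition.le_one _
  have hle (n : ℕ) : ∫ x in Ω, h n (w x) * divergence η x ≤ ∫ x in Ω, p x * h n (w x) :=
    integral_comp_mul_divergence_le hφ hΩ hw hp hwTV hsub heq (hd n)
      (fun t => by
        rw [hderiv]
        exact mul_nonneg n.cast_nonneg (smoothTransition_deriv_nonneg _))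
      (C := n * C)
      (fun t => by
        rw [hderiv]
        exact mul_le_mul_of_nonneg_left (hC _) n.cast_nonneg)
      (hB n) hη
  have hmeas (n : ℕ) : AEStronglyMeasurable (fun x => h n (w x)) (volume.restrict Ω) :=
    (hd n).continuous.comp_aestronglyMeasurable hw.1
  refine le_of_tendsto_of_tendsto' (f := fun n => ∫ x in Ω, h n (w x) * divergence η x)
    (g := fun n => ∫ x in Ω, p x * h n (w x)) (b := atTop) ?_ ?_ hle
  · refine tendsto_integral_of_dominated_convergence (fun x => ‖divergence η x‖) ?_ ?_ ?_ ?_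
    · exact fun n => (hmeas n).mul (continuous_divergence hη.contDiff).aestronglyMeasurable
    · exact (integrable_divergence hη.contDiff hη.hasCompactSupport).norm.integrableOn
    · refine fun n => .of_forall fun x => ?_
      rw [norm_mul]
      exact mul_le_of_le_one_left (norm_nonneg _) (hB n _)
    · exact .of_forall fun x => (tendsto_smoothTransition_indicator s (w x)).mul_const _
  · refine tendsto_integral_of_dominated_convergence (fun x => ‖p x‖) ?_ ?_ ?_ ?_
    · exact fun n => hp.1.mul (hmeas n)
    · exact (hp.integrable one_le_two).norm
    · refine fun n => .of_forall fun x => ?_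
      rw [norm_mul]
      exact mul_le_of_le_one_right (norm_nonneg _) (hB n _)
    · exact .of_forall fun x => (tendsto_smoothTransition_indicator s (w x)).const_mul _

/-! ### Optimality conditions for the ROF functional -/

lemma AROF_eq {f u : Plane → ℝ} {lam : ℝ} (hlam : 0 ≤ lam)
    (hf : MemLp f 2 (volume.restrict Ω)) (hu : MemLp u 2 (volume.restrict Ω))
    (hTV : totalVariation l1 Ω u ≠ ∞) :
    AROF Ω f lam u = ENNReal.ofReal
      ((totalVariation l1 Ω u).toReal + lam / 2 * ∫ x in Ω, (u x - f x) ^ 2) := by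
  have hi : Integrable (fun x => (u x - f x) ^ 2) (volume.restrict Ω) :=
    (hu.sub hf).integrable_sq
  rw [AROF, ← ofReal_integral_eq_lintegral_ofReal hi (.of_forall fun x => sq_nonneg _),
    ← ENNReal.ofReal_mul (by positivity),
    ENNReal.ofReal_add ENNReal.toReal_nonneg
      (mul_nonneg (by positivity) (integral_nonneg fun x => sq_nonneg _)),
    ENNReal.ofReal_toReal hTV]

lemma totalVariation_ne_top_of_isMinimizerL2 {f w : Plane → ℝ} {lam : ℝ}
    (hf : MemLp f 2 (volume.restrict Ω)) (hw : IsMinimizerL2 Ω (AROF Ω f lam) w) :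
    totalVariation l1 Ω w ≠ ∞ := by
  have h0 : AROF Ω f lam (fun _ => 0) ≠ ∞ := by
    have hTV : totalVariation l1 Ω (fun _ => 0) = 0 := by simp [totalVariation]
    have hi : Integrable (fun x => f x ^ 2) (volume.restrict Ω) := hf.integrable_sq
    simp only [AROF, hTV, zero_add, zero_sub, neg_sq]
    rw [← ofReal_integral_eq_lintegral_ofReal hi (.of_forall fun x => sq_nonneg _)]
    exact ENNReal.mul_ne_top ENNReal.ofReal_ne_top ENNReal.ofReal_ne_top
  exact ne_top_of_le_ne_top h0 (le_self_add.trans (hw.2 _ MemLp.zero'))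

/-- First variation of the ROF functional at a minimizer: a linear bound on the total variation
along the ray `w + t v` bounds the derivative of the quadratic term from below. -/
lemma integral_mul_le_of_isMinimizerL2 {f w : Plane → ℝ} {lam : ℝ} (hlam : 0 ≤ lam)
    (hf : MemLp f 2 (volume.restrict Ω)) (hw : IsMinimizerL2 Ω (AROF Ω f lam) w)
    {v : Plane → ℝ} (hv : MemLp v 2 (volume.restrict Ω)) {A : ℝ}
    (hA : ∀ t : ℝ, 0 < t → t < 1 → ∀ η, IsTestField l1 Ω η →
      ∫ x in Ω, (w x + t * v x) * divergence η x ≤ (totalVariation l1 Ω w).toReal + t * A) :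
    ∫ x in Ω, lam * (f x - w x) * v x ≤ A := by
  have hwTV := totalVariation_ne_top_of_isMinimizerL2 hf hw
  have hwL := hw.1
  set Q := ∫ x in Ω, (v x) ^ 2
  set P := ∫ x in Ω, (w x - f x) * v x with hP
  have hPi : IntegrableOn (fun x => (w x - f x) * v x) Ω := (hwL.sub hf).integrable_mul hv
  have hgoal : ∫ x in Ω, lam * (f x - w x) * v x = - (lam * P) := by
    rw [hP, ← integral_const_mul, ← integral_neg]
    congr 1 with x
    ring
  have key (t : ℝ) (ht0 : 0 < t) (ht1 : t < 1) : - (lam * P) ≤ A + t * (lam / 2 * Q) := by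
    have htv : MemLp (fun x => w x + t * v x) 2 (volume.restrict Ω) := hwL.add (hv.const_mul t)
    have hnn : 0 ≤ (totalVariation l1 Ω w).toReal + t * A := by
      simpa [divergence] using hA t ht0 ht1 0 (isTestField_zero l1_nonneg)
    have hTV := totalVariation_le (hA t ht0 ht1)
    have hfin := ne_top_of_le_ne_top ENNReal.ofReal_ne_top hTV
    have hTV' := ENNReal.toReal_le_of_le_ofReal hnn hTV
    have hmin := hw.2 _ htv
    rw [AROF_eq hlam hf hwL hwTV, AROF_eq hlam hf htv hfin, ENNReal.ofReal_le_ofReal_iff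
      (add_nonneg ENNReal.toReal_nonneg
        (mul_nonneg (by positivity) (integral_nonneg fun x => sq_nonneg _)))] at hmin
    have hexp : ∫ x in Ω, (w x + t * v x - f x) ^ 2
        = (∫ x in Ω, (w x - f x) ^ 2) + 2 * t * P + t ^ 2 * Q := by
      have h1 : Integrable (fun x => (w x - f x) ^ 2) (volume.restrict Ω) :=
        (hwL.sub hf).integrable_sq
      have h2 : Integrable (fun x => 2 * t * ((w x - f x) * v x)) (volume.restrict Ω) :=
        hPi.const_mul _
      have h3 : Integrable (fun x => t ^ 2 * (v x) ^ 2) (volume.restrict Ω) :=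
        hv.integrable_sq.const_mul _
      have h12 : Integrable (fun x => (w x - f x) ^ 2 + 2 * t * ((w x - f x) * v x))
          (volume.restrict Ω) := h1.add h2
      rw [← integral_const_mul, ← integral_const_mul, ← integral_add h1 h2,
        ← integral_add h12 h3]
      congr 1 with x
      ring
    rw [hexp] at hmin
    have : 0 ≤ t * (A + t * (lam / 2 * Q) + lam * P) := by linarith
    have := nonneg_of_mul_nonneg_right this ht0
    linarith
  rw [hgoal]
  have hlim : Tendsto (fun t : ℝ => A + t * (lam / 2 * Q)) (𝓝[>] 0) (𝓝 A) := by
    have : Continuous fun t : ℝ => A + t * (lam / 2 * Q) := by fun_prop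
    simpa using (this.tendsto 0).mono_left nhdsWithin_le_nhds
  refine ge_of_tendsto hlim ?_
  filter_upwards [Ioo_mem_nhdsGT (zero_lt_one' ℝ)] with t ht
  exact key t ht.1 ht.2

/-- Euler-Lagrange inequality: `lam (f - w)` lies in the polar of the total variation. -/
lemma integral_mul_le_totalVariation [IsFiniteMeasure (volume.restrict Ω)] {f w : Plane → ℝ}
    {lam : ℝ} (hlam : 0 ≤ lam)
    (hf : MemLp f 2 (volume.restrict Ω)) (hw : IsMinimizerL2 Ω (AROF Ω f lam) w)
    {v : Plane → ℝ} (hv : MemLp v 2 (volume.restrict Ω)) (hvTV : totalVariation l1 Ω v ≠ ∞) :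
    ∫ x in Ω, lam * (f x - w x) * v x ≤ (totalVariation l1 Ω v).toReal := by
  refine integral_mul_le_of_isMinimizerL2 hlam hf hw hv fun t ht0 _ η hη => ?_
  have hw1 := integrable_mul_divergence (hw.1.integrable one_le_two) hη
  have hv1 := (integrable_mul_divergence (hv.integrable one_le_two) hη).const_mul t
  have hsum : ∫ x in Ω, (w x + t * v x) * divergence η x
      = (∫ x in Ω, w x * divergence η x) + t * ∫ x in Ω, v x * divergence η x := by
    rw [← integral_const_mul, ← integral_add hw1 hv1]
    congr 1 with x
    ring
  rw [hsum]
  have := integral_mul_divergence_le (totalVariation_ne_top_of_isMinimizerL2 hf hw) hη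
  have := mul_le_mul_of_nonneg_left (integral_mul_divergence_le hvTV hη) ht0.le
  linarith

/-- Euler-Lagrange equation tested with `w` itself, by shrinking `w` along `(1 - t) w`. -/
lemma totalVariation_le_integral_mul {f w : Plane → ℝ} {lam : ℝ} (hlam : 0 ≤ lam)
    (hf : MemLp f 2 (volume.restrict Ω)) (hw : IsMinimizerL2 Ω (AROF Ω f lam) w) :
    (totalVariation l1 Ω w).toReal ≤ ∫ x in Ω, lam * (f x - w x) * w x := by
  have h := integral_mul_le_of_isMinimizerL2 hlam hf hw hw.1.neg
    (A := - (totalVariation l1 Ω w).toReal) fun t _ ht1 η hη => by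
      have hsum : ∫ x in Ω, (w x + t * (-w) x) * divergence η x
          = (1 - t) * ∫ x in Ω, w x * divergence η x := by
        rw [← integral_const_mul]
        congr 1 with x
        simp only [Pi.neg_apply]
        ring
      rw [hsum]
      have := mul_le_mul_of_nonneg_left
        (integral_mul_divergence_le (totalVariation_ne_top_of_isMinimizerL2 hf hw) hη)
        (sub_nonneg.2 ht1.le)
      linarith
  simp only [Pi.neg_apply, mul_neg, integral_neg] at h
  linarith

/-! ### The relaxed functional -/

lemma measurable_convexIndicator : Measurable convexIndicator := by
  classical
  have : convexIndicator = fun s : ℝ => if s ∈ Icc (0 : ℝ) 1 then (0 : ℝ≥0∞) else ⊤ := by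
    funext s
    simp only [convexIndicator]
  rw [this]
  exact Measurable.ite measurableSet_Icc measurable_const measurable_const

lemma ae_mem_Icc_of_relaxedG_ne_top {f u : Plane → ℝ} {μ c₁ c₂ : ℝ}
    (hu : AEMeasurable u (volume.restrict Ω)) (hG : relaxedG Ω f μ c₁ c₂ u ≠ ∞) :
    ∀ᵐ x ∂(volume.restrict Ω), u x ∈ Icc (0 : ℝ) 1 := by
  have h := (ENNReal.add_ne_top.1 hG).2
  filter_upwards [ae_lt_top' (measurable_convexIndicator.comp_aemeasurable hu) h] with x hx
  by_contra hn
  simp [convexIndicator, hn] at hx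

lemma integrable_fidelity [IsFiniteMeasure (volume.restrict Ω)] {f u : Plane → ℝ}
    (hf : MemLp f 2 (volume.restrict Ω)) (c₁ c₂ : ℝ)
    (hu : AEStronglyMeasurable u (volume.restrict Ω))
    (hu01 : ∀ᵐ x ∂(volume.restrict Ω), u x ∈ Icc (0 : ℝ) 1) :
    IntegrableOn (fun x => u x * (c₁ - f x) ^ 2 + (1 - u x) * (c₂ - f x) ^ 2) Ω := by
  have hsq (c : ℝ) : Integrable (fun x => (c - f x) ^ 2) (volume.restrict Ω) :=
    ((memLp_const c).sub hf).integrable_sq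
  refine ((hsq c₁).bdd_mul (c := 1) hu ?_).add
    ((hsq c₂).bdd_mul (c := 1) (aestronglyMeasurable_const.sub hu) ?_)
  · filter_upwards [hu01] with x hx
    rw [Real.norm_eq_abs, abs_of_nonneg hx.1]
    exact hx.2
  · filter_upwards [hu01] with x hx
    rw [Real.norm_eq_abs, abs_of_nonneg (sub_nonneg.2 hx.2)]
    linarith [hx.1]

lemma relaxedG_eq [IsFiniteMeasure (volume.restrict Ω)] {f u : Plane → ℝ}
    (hf : MemLp f 2 (volume.restrict Ω)) {μ : ℝ} (hμ : 0 ≤ μ) (c₁ c₂ : ℝ)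
    (hu : AEStronglyMeasurable u (volume.restrict Ω))
    (hu01 : ∀ᵐ x ∂(volume.restrict Ω), u x ∈ Icc (0 : ℝ) 1) :
    relaxedG Ω f μ c₁ c₂ u = totalVariation l1 Ω u + ENNReal.ofReal
      (μ * ∫ x in Ω, (u x * (c₁ - f x) ^ 2 + (1 - u x) * (c₂ - f x) ^ 2)) := by
  have h0 : ∫⁻ x in Ω, convexIndicator (u x) = 0 := by
    rw [← lintegral_zero (μ := volume.restrict Ω)]
    refine lintegral_congr_ae ?_
    filter_upwards [hu01] with x hx
    simp [convexIndicator, hx]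
  rw [relaxedG, h0, add_zero, ENNReal.ofReal_mul hμ,
    ofReal_integral_eq_lintegral_ofReal (integrable_fidelity hf c₁ c₂ hu hu01)]
  filter_upwards [hu01] with x hx
  exact add_nonneg (mul_nonneg hx.1 (sq_nonneg _))
    (mul_nonneg (sub_nonneg.2 hx.2) (sq_nonneg _))

end AnisoCV

/-! ### Minimality of the super-level set -/

open AnisoCV

theorem mainTheorem2 (Ω : Set AnisoCV.Plane) (hΩ : IsOpen Ω) (hΩb : Bornology.IsBounded Ω)
    (f : AnisoCV.Plane → ℝ) (hf : MemLp f 2 (volume.restrict Ω))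
    (μ c₁ c₂ : ℝ) (hμ : 0 < μ) (hc₂ : 0 ≤ c₂) (hc : c₂ < c₁) (hc₁ : c₁ ≤ 1)
    (w : AnisoCV.Plane → ℝ)
    (hw : AnisoCV.IsMinimizerL2 Ω (AnisoCV.AROF Ω f (2 * μ * (c₁ - c₂))) w) :
    AnisoCV.IsMinimizerL2 Ω (AnisoCV.relaxedG Ω f μ c₁ c₂)
      (Set.indicator {x | x ∈ Ω ∧ (c₁ + c₂) / 2 < w x} (fun _ => (1 : ℝ))) := by
  have hfin : IsFiniteMeasure (volume.restrict Ω) :=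
    isFiniteMeasure_restrict.2 hΩb.measure_lt_top.ne
  set s := (c₁ + c₂) / 2 with hs
  set lam := 2 * μ * (c₁ - c₂) with hlam_def
  have hlam : 0 ≤ lam := by have := sub_pos.2 hc; positivity
  set χ : Plane → ℝ := Set.indicator {x | x ∈ Ω ∧ s < w x} (fun _ => (1 : ℝ)) with hχ
  have hχm : AEStronglyMeasurable χ (volume.restrict Ω) :=
    aestronglyMeasurable_const.indicator₀ (hΩ.measurableSet.nullMeasurableSet.inter
      (nullMeasurableSet_lt aemeasurable_const hw.1.1.aemeasurable))
  have hχcases (x : Plane) : χ x = 0 ∨ χ x = 1 := Set.indicator_eq_zero_or_self _ _ x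
  have hχ01 (x : Plane) : χ x ∈ Icc (0 : ℝ) 1 := by
    rcases hχcases x with h | h <;> simp [h]
  have hχL : MemLp χ 2 (volume.restrict Ω) :=
    MemLp.of_bound hχm 1 (.of_forall fun x => by
      rw [Real.norm_eq_abs, abs_of_nonneg (hχ01 x).1]
      exact (hχ01 x).2)
  have hχΩ {x : Plane} (hx : x ∈ Ω) : χ x = (Ioi s).indicator (fun _ => (1 : ℝ)) (w x) := by
    simp only [hχ, Set.indicator, mem_ofPred_eq, hx, true_and, mem_Ioi]
  refine ⟨hχL, fun u hu => ?_⟩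
  by_cases hG : relaxedG Ω f μ c₁ c₂ u = ∞
  · rw [hG]
    exact le_top
  have hu01 := ae_mem_Icc_of_relaxedG_ne_top hu.1.aemeasurable hG
  have huTV : totalVariation l1 Ω u ≠ ∞ :=
    (ENNReal.add_ne_top.1 (ENNReal.add_ne_top.1 hG).1).1
  set p : Plane → ℝ := fun x => lam * (f x - w x) with hp_def
  have hp : MemLp p 2 (volume.restrict Ω) := (hf.sub hw.1).const_mul lam
  have hχtest (η : Plane → Plane) (hη : IsTestField l1 Ω η) :
      ∫ x in Ω, χ x * divergence η x ≤ ∫ x in Ω, p x * χ x := by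
    have h := integral_superlevel_mul_divergence_le l1_nonneg hΩ hw.1 hp
      (totalVariation_ne_top_of_isMinimizerL2 hf hw)
      (fun v hv hvTV => integral_mul_le_totalVariation hlam hf hw hv hvTV)
      (totalVariation_le_integral_mul hlam hf hw) s hη
    have e1 : ∫ x in Ω, χ x * divergence η x
        = ∫ x in Ω, (Ioi s).indicator (fun _ => (1 : ℝ)) (w x) * divergence η x :=
      setIntegral_congr_fun hΩ.measurableSet fun x hx => by simp only [hχΩ hx]
    have e2 : ∫ x in Ω, p x * χ x = ∫ x in Ω, p x * (Ioi s).indicator (fun _ => (1 : ℝ)) (w x) :=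
      setIntegral_congr_fun hΩ.measurableSet fun x hx => by simp only [hχΩ hx]
    rwa [e1, e2]
  have hχp : 0 ≤ ∫ x in Ω, p x * χ x := by
    simpa [divergence] using hχtest 0 (isTestField_zero l1_nonneg)
  have hfid {z : Plane → ℝ} (hz : ∀ᵐ x ∂(volume.restrict Ω), z x ∈ Icc (0 : ℝ) 1) :
      0 ≤ μ * ∫ x in Ω, (z x * (c₁ - f x) ^ 2 + (1 - z x) * (c₂ - f x) ^ 2) := by
    refine mul_nonneg hμ.le (integral_nonneg_of_ae ?_)
    filter_upwards [hz] with x hx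
    exact add_nonneg (mul_nonneg hx.1 (sq_nonneg _))
      (mul_nonneg (sub_nonneg.2 hx.2) (sq_nonneg _))
  have hpu : ∫ x in Ω, p x * u x ≤ (totalVariation l1 Ω u).toReal :=
    integral_mul_le_totalVariation hlam hf hw hu huTV
  have hχi := integrable_fidelity hf c₁ c₂ hχm (.of_forall hχ01)
  have hui := integrable_fidelity hf c₁ c₂ hu.1 hu01
  -- The integrand is `lam (s - w) z + μ (c₂ - f)²`, so it is minimal over `z ∈ [0, 1]` at `χ`.
  have hcmp : (∫ x in Ω, p x * χ x)
      + μ * (∫ x in Ω, (χ x * (c₁ - f x) ^ 2 + (1 - χ x) * (c₂ - f x) ^ 2))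
      ≤ (∫ x in Ω, p x * u x)
        + μ * ∫ x in Ω, (u x * (c₁ - f x) ^ 2 + (1 - u x) * (c₂ - f x) ^ 2) := by
    have hpχi : Integrable (fun x => p x * χ x) (volume.restrict Ω) := hp.integrable_mul hχL
    have hpui : Integrable (fun x => p x * u x) (volume.restrict Ω) := hp.integrable_mul hu
    rw [← integral_const_mul, ← integral_const_mul, ← integral_add hpχi (hχi.const_mul μ),
      ← integral_add hpui (hui.const_mul μ)]
    refine integral_mono_ae (hpχi.add (hχi.const_mul μ)) (hpui.add (hui.const_mul μ)) ?_
    filter_upwards [hu01, ae_restrict_mem hΩ.measurableSet] with x hx hxΩ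
    have hdiff (z : ℝ) : p x * z + μ * (z * (c₁ - f x) ^ 2 + (1 - z) * (c₂ - f x) ^ 2)
        = lam * ((s - w x) * z) + μ * (c₂ - f x) ^ 2 := by
      simp only [hp_def, hlam_def, hs]
      ring
    have hpt : (s - w x) * χ x ≤ (s - w x) * u x := by
      by_cases hxs : s < w x
      · have : χ x = 1 := Set.indicator_of_mem (show x ∈ {x | x ∈ Ω ∧ s < w x} from ⟨hxΩ, hxs⟩) _
        rw [this]
        nlinarith [hx.2]
      · have : χ x = 0 :=
          Set.indicator_of_notMem (show x ∉ {x | x ∈ Ω ∧ s < w x} from fun h => hxs h.2) _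
        rw [this]
        nlinarith [hx.1]
    simp only [hdiff]
    linarith [mul_le_mul_of_nonneg_left hpt hlam]
  rw [relaxedG_eq hf hμ.le c₁ c₂ hχm (.of_forall hχ01), relaxedG_eq hf hμ.le c₁ c₂ hu.1 hu01]
  calc totalVariation l1 Ω χ + ENNReal.ofReal
        (μ * ∫ x in Ω, (χ x * (c₁ - f x) ^ 2 + (1 - χ x) * (c₂ - f x) ^ 2))
      ≤ ENNReal.ofReal (∫ x in Ω, p x * χ x) + ENNReal.ofReal
        (μ * ∫ x in Ω, (χ x * (c₁ - f x) ^ 2 + (1 - χ x) * (c₂ - f x) ^ 2)) := by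
        gcongr
        exact totalVariation_le hχtest
    _ ≤ ENNReal.ofReal (totalVariation l1 Ω u).toReal + ENNReal.ofReal
        (μ * ∫ x in Ω, (u x * (c₁ - f x) ^ 2 + (1 - u x) * (c₂ - f x) ^ 2)) := by
        rw [← ENNReal.ofReal_add hχp (hfid (.of_forall hχ01)),
          ← ENNReal.ofReal_add ENNReal.toReal_nonneg (hfid hu01)]
        exact ENNReal.ofReal_le_ofReal (by linarith)
    _ = _ := by rw [ENNReal.ofReal_toReal huTV]
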